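/- Conventions. A finite graph is regarded as a topological space in the usual way. A generic immersion of a finite graph $G$ into $\mathbb{R}^2$ is a continuous piecewise linear map $G\to\mathbb{R}^2$ whose multiple points are only finitely many transversal double points of interior points of edges. A cycle of $G$ is a subgraph of $G$ homeomorphic to a circle, and $\Gamma_m(G)$ is the set of cycles of $G$ with exactly $m$ vertices. An $n$-chord diagram on an oriented circle $S$ is a set of $2n$ distinct points of $S$ grouped into $n$ pairs; a sub-chord diagram of it is a chord diagram on $S$ all of whose pairs are among its pairs. Chord diagrams on oriented circles $S_1$ and $S_2$ are equivalent if there is an orientation preserving homeomorphism $S_1\to S_2$ that maps the pairs of the first onto the pairs of the second. If $f$ is a generic immersion of $G$ and $\gamma$ is an oriented cycle of $G$, then $\mathcal{C}(f|_\gamma)$ is the chord diagram on $\gamma$ whose pairs are the pairs of distinct points of $\gamma$ with the same image under $f$. The unit circle $\mathbb{S}^1$ is oriented counterclockwise, and $K_m$ is the complete graph on $m$ vertices. Theorem. Let $n\ge 2$ be a natural number, let $\mathcal{C}$ be an $n$-chord diagram on $\mathbb{S}^1$, and let $f:K_{4n}\to\mathbb{R}^2$ be a generic immersion. Then there are a cycle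 $\gamma\in\Gamma_{4n}(K_{4n})$, an orientation of $\gamma$, and a sub-chord diagram $\mathcal{D}$ of $\mathcal{C}(f|_\gamma)$ such that $\mathcal{D}$ is equivalent to $\mathcal{C}$. -/

import Mathlib

namespace PlaneCurves

/-- The Euclidean plane. -/
abbrev Plane : Type := EuclideanSpace ℝ (Fin 2)

/-! Orientations of circles -/

/-- A self-homeomorphism of the unit circle (oriented counterclockwise) preserves the orientation
if it lifts to a strictly increasing continuous map of the angle coordinate. -/
def PreservesCircleOrientation (φ : Circle ≃ₜ Circle) : Prop :=
  ∃ F : ℝ → ℝ, Continuous F ∧ StrictMono F ∧ ∀ t : ℝ, φ (Circle.exp t) = Circle.exp (F t)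

/-- An orientation of a topological circle `S`: the set of its positive parametrizations by the
unit circle, which is one class of parametrizations modulo orientation preserving
self-homeomorphisms of the unit circle. -/
structure CircleOrientation (S : Type*) [TopologicalSpace S] where
  positive : Set (Circle ≃ₜ S)
  isClass : ∃ p : Circle ≃ₜ S, positive = {q | PreservesCircleOrientation (p.trans q.symm)}

/-- The orientation of `S` for which the parametrization `p` is positive. -/
noncomputable def CircleOrientation.ofHomeomorph {S : Type*} [TopologicalSpace S] (p : Circle ≃ₜ S) :
    CircleOrientation S where
  positive := {q | PreservesCircleOrientation (p.trans q.symm)}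
  isClass := ⟨p, rfl⟩

/-- The counterclockwise orientation of the unit circle. -/
noncomputable def CircleOrientation.counterclockwise : CircleOrientation Circle :=
  CircleOrientation.ofHomeomorph (Homeomorph.refl Circle)

/-- A homeomorphism of oriented circles preserves the orientations. -/
def PreservesOrientation {S T : Type*} [TopologicalSpace S] [TopologicalSpace T]
    (o : CircleOrientation S) (o' : CircleOrientation T) (h : S ≃ₜ T) : Prop :=
  ∀ p ∈ o.positive, p.trans h ∈ o'.positive

/-! Chord diagrams -/

/-- A chord diagram on `S`: finitely many points of `S`, grouped into pairs. It is given by the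
set of its pairs; each pair consists of two distinct points, and no point is in two pairs. -/
structure ChordDiagram (S : Type*) where
  chords : Set (Sym2 S)
  finite : chords.Finite
  not_isDiag : ∀ z ∈ chords, ¬ z.IsDiag
  eq_of_mem : ∀ z ∈ chords, ∀ w ∈ chords, ∀ x : S, x ∈ z → x ∈ w → z = w

/-- `C` is an `n`-chord diagram when `C.size = n`. -/
noncomputable def ChordDiagram.size {S : Type*} (C : ChordDiagram S) : ℕ := C.chords.ncard

/-- `D` is a sub-chord diagram of `C`. -/
def ChordDiagram.IsSub {S : Type*} (D C : ChordDiagram S) : Prop := D.chords ⊆ C.chords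

/-- Equivalence of a chord diagram on the oriented circle `(S, o)` and one on `(T, o')`: some
orientation preserving homeomorphism carries the pairs of the first to the pairs of the second. -/
def ChordDiagram.Equivalent {S T : Type*} [TopologicalSpace S] [TopologicalSpace T]
    (o : CircleOrientation S) (C : ChordDiagram S)
    (o' : CircleOrientation T) (D : ChordDiagram T) : Prop :=
  ∃ h : S ≃ₜ T, PreservesOrientation o o' h ∧ Sym2.map h '' C.chords = D.chords

/-! Graphs as topological spaces -/

section Graphs

variable {V : Type*} [DecidableEq V] {G : SimpleGraph V}

/-- The point of `V → ℝ` that represents the vertex `v`. -/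
def vertexPoint (v : V) : V → ℝ := Pi.single v 1

/-- The subgraph `H` as a topological space: the union of its vertices and of the straight
segments that represent its edges, inside the standard simplex spanned by all the vertices. (The
vertex set is meant to be finite. The whole graph `G` is the case `H = ⊤`.) -/
def space (H : G.Subgraph) : Set (V → ℝ) :=
  {x | (∃ v ∈ H.verts, x = vertexPoint v) ∨
    ∃ u v, H.Adj u v ∧ x ∈ segment ℝ (vertexPoint u) (vertexPoint v)}

/-- The affine parametrization by `[0, 1]` of an edge, from its endpoint `u` to `v`. -/
noncomputable def edgeMap (H : G.Subgraph) {u v : V} (huv : H.Adj u v) (t : unitInterval) :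
    space H :=
  ⟨AffineMap.lineMap (vertexPoint u) (vertexPoint v) (t : ℝ), Or.inr ⟨u, v, huv, by
    rw [segment_eq_image_lineMap]
    exact ⟨(t : ℝ), t.2, rfl⟩⟩⟩

theorem space_mono {H K : G.Subgraph} (h : H ≤ K) : space H ⊆ space K := by
  rintro x (⟨v, hv, hx⟩ | ⟨u, v, huv, hx⟩)
  · exact Or.inl ⟨v, h.1 hv, hx⟩
  · exact Or.inr ⟨u, v, h.2 huv, hx⟩

/-- `γ` is an `n`-cycle of `G`: a subgraph with exactly `n` vertices that is homeomorphic to a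
circle. -/
def IsCycleOfLength (n : ℕ) (γ : G.Subgraph) : Prop :=
  Nonempty (Circle ≃ₜ space γ) ∧ γ.verts.ncard = n

/-- The complete graph on `m` vertices. -/
abbrev K (m : ℕ) : SimpleGraph (Fin m) := ⊤

/-! Generic immersions -/

/-- A path in the plane is piecewise linear: it is continuous, and it is affine on each interval
with no interior point in some finite set `T`. -/
def IsPiecewiseLinear (g : unitInterval → Plane) : Prop :=
  Continuous g ∧ ∃ T : Finset unitInterval, ∀ a b : unitInterval, a ≤ b →
    (∀ t ∈ T, t ∉ Set.Ioo a b) →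
      ∃ A : ℝ →ᵃ[ℝ] Plane, ∀ t ∈ Set.Icc a b, g t = A (t : ℝ)

/-- The multiple points of a map. -/
def multiplePoints {X : Type*} (f : X → Plane) : Set Plane :=
  {p | ∃ x y, x ≠ y ∧ f x = p ∧ f y = p}

/-- The branches of `f` at `x` and at `y`, where `f x = f y`, cross transversally: a homeomorphism
from a neighbourhood of the common image to a neighbourhood of the origin carries the branch at `x`
into the horizontal axis and the branch at `y` into the vertical axis. (If `x` and `y` have open
arcs as neighbourhoods on which `f` is injective, these branches are then neighbourhoods of the
origin in the two axes.) -/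
def IsTransversalAt {X : Type*} [TopologicalSpace X] (f : X → Plane) (x y : X) : Prop :=
  ∃ Φ : OpenPartialHomeomorph Plane Plane, f x ∈ Φ.source ∧ Φ (f x) = 0 ∧
    (∀ᶠ z in nhds x, Φ (f z) 1 = 0) ∧ (∀ᶠ z in nhds y, Φ (f z) 0 = 0)

/-- A (piecewise linear) generic immersion of the finite graph `H` into the plane: a piecewise
linear continuous map whose multiple points are only finitely many transversal double points of
interior points of edges. -/
structure IsGenericImmersion (H : G.Subgraph) (f : space H → Plane) : Prop where
  continuous : Continuous f
  piecewiseLinear : ∀ {u v : V} (huv : H.Adj u v), IsPiecewiseLinear (fun t => f (edgeMap H huv t))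
  finite : (multiplePoints f).Finite
  double : ∀ x y, x ≠ y → f x = f y → ∀ z, f z = f x → z = x ∨ z = y
  interior : ∀ x y, x ≠ y → f x = f y → ∀ v : V, (x : V → ℝ) ≠ vertexPoint v
  transversal : ∀ x y, x ≠ y → f x = f y → IsTransversalAt f x y

/-- The restriction of a map to the subspace of a subgraph. -/
def restrict {H K : G.Subgraph} (h : H ≤ K) (f : space K → Plane) : space H → Plane :=
  fun x => f (Set.inclusion (space_mono h) x)

theorem IsGenericImmersion.restrict {H K : G.Subgraph} {f : space K → Plane}
    (hf : IsGenericImmersion K f) (h : H ≤ K) : IsGenericImmersion H (restrict h f) := by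
  have inj := Set.inclusion_injective (space_mono h)
  have cont : Continuous (Set.inclusion (space_mono h)) := continuous_inclusion _
  refine ⟨hf.continuous.comp cont, fun huv => hf.piecewiseLinear (h.2 huv),
    hf.finite.subset ?_, fun x y hxy e z hz => ?_,
    fun x y hxy e v => hf.interior _ _ (inj.ne hxy) e v, fun x y hxy e => ?_⟩
  · rintro p ⟨x, y, hxy, hx, hy⟩
    exact ⟨_, _, inj.ne hxy, hx, hy⟩
  · exact (hf.double _ _ (inj.ne hxy) e _ hz).imp (fun k => inj k) (fun k => inj k)
  · obtain ⟨Φ, h1, h2, h3, h4⟩ := hf.transversal _ _ (inj.ne hxy) e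
    exact ⟨Φ, h1, h2, cont.continuousAt.eventually h3, cont.continuousAt.eventually h4⟩

/-- The chord diagram of a generic immersion: its pairs are the pairs of distinct points with the
same image. (It is used when `H` is a cycle, so that `f` is a plane curve.) -/
def IsGenericImmersion.chordDiagram {H : G.Subgraph} {f : space H → Plane}
    (hf : IsGenericImmersion H f) : ChordDiagram (space H) where
  chords := {z | ∃ x y, x ≠ y ∧ f x = f y ∧ z = s(x, y)}
  finite := by
    have hfib : (f ⁻¹' multiplePoints f).Finite := by
      refine hf.finite.preimage' ?_
      rintro p ⟨x, y, hxy, hx, hy⟩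
      refine (Set.toFinite {x, y}).subset fun z hz => ?_
      exact hf.double x y hxy (hx.trans hy.symm) z (Eq.trans hz hx.symm)
    refine ((hfib.prod hfib).image fun q => s(q.1, q.2)).subset ?_
    rintro z ⟨x, y, hxy, e, rfl⟩
    exact ⟨(x, y), ⟨⟨x, y, hxy, rfl, e.symm⟩, ⟨x, y, hxy, e, rfl⟩⟩, rfl⟩
  not_isDiag := by
    rintro z ⟨x, y, hxy, -, rfl⟩
    simpa using hxy
  eq_of_mem := by
    have key : ∀ a b c, a ≠ b → f a = f b → a ≠ c → f a = f c → b = c := by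
      intro a b c hab eab hac eac
      rcases hf.double a b hab eab c eac.symm with k | k
      · exact absurd k.symm hac
      · exact k.symm
    rintro z ⟨x, y, hxy, e, rfl⟩ w ⟨x', y', hxy', e', rfl⟩ p hp hp'
    rw [Sym2.mem_iff] at hp hp'
    rcases hp with rfl | rfl <;> rcases hp' with rfl | rfl
    · rw [key _ _ _ hxy e hxy' e']
    · rw [key _ _ _ hxy e hxy'.symm e'.symm, Sym2.eq_swap]
    · rw [key _ _ _ hxy.symm e.symm hxy' e', Sym2.eq_swap]
    · rw [key _ _ _ hxy.symm e.symm hxy'.symm e'.symm]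

end Graphs

end PlaneCurves

open PlaneCurves

namespace PlaneCurves

/-! The total change of argument along a path in the punctured plane -/

/-! Give each of the `2 * n` endpoints of the diagram an edge of its own, so that the edges of
paired endpoints cross, and run a Hamiltonian cycle through these edges in the cyclic order of the
endpoints. Each chord then becomes a double point of the curve.

Crossings come from van Kampen: among any five vertices two disjoint edges cross
(`exists_crossing_of_five_points`, `exists_crosses`). If disjoint edges never met, the change of
argument of the difference of two edges around the parameter square would vanish; summed over all 15
pairs of disjoint edges this contradicts parity.

A chord uses up four vertices, so a greedy choice serves all chords but the last, for which only
four vertices remain. The fifth is borrowed: take consecutive endpoints `i₀`, `i₁` that are not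
paired (here `2 ≤ n` enters), leave the chord at `i₁` for last, and add the final vertex of the edge
at `i₀`. If the crossing uses the borrowed vertex, its edge joins the edge at `i₀` to the first
vertex at `i₁`, and the Hamiltonian cycle contains that connecting edge at the right place anyway
(`exists_vertex_arrangement`).

`exists_realization` turns such an arrangement into a parametrized cycle. -/

theorem exists_continuous_log {X : Type*} [TopologicalSpace X] [LocallyPathConnectedSpace X]
    [ContractibleSpace X] {g : X → ℂ} (hg : Continuous g) (h0 : ∀ x, g x ≠ 0) :
    ∃ L : X → ℂ, Continuous L ∧ ∀ x, Complex.exp (L x) = g x := by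
  have hU : IsSimplyConnected (Set.univ : Set X) := by
    have : ContractibleSpace (Set.univ : Set X) := (Homeomorph.Set.univ X).contractibleSpace
    exact inferInstanceAs (SimplyConnectedSpace (Set.univ : Set X))
  obtain ⟨L, hL, h⟩ := Complex.exists_continuousOn_eqOn_exp_comp hU isOpen_univ hg.continuousOn
    (by simpa using h0)
  exact ⟨L, continuousOn_univ.1 hL, fun x => h (Set.mem_univ x)⟩

/-- The total change of argument of `g` on `[0, 1]`. -/
noncomputable def turn (g : ℝ → ℂ) : ℝ :=
  open Classical in
  if h : ∃ L : ℝ → ℂ, Continuous L ∧ ∀ t, Complex.exp (L t) = g t then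
    (h.choose 1 - h.choose 0).im else 0

/-- Two continuous logarithms differ by a continuous, hence constant, integer multiple of `2πi`, so
the choice in `turn` is immaterial. -/
theorem turn_eq {g L : ℝ → ℂ} (hL : Continuous L) (hg : ∀ t, Complex.exp (L t) = g t) :
    turn g = (L 1 - L 0).im := by
  have h : ∃ L : ℝ → ℂ, Continuous L ∧ ∀ t, Complex.exp (L t) = g t := ⟨L, hL, hg⟩
  obtain ⟨hM, hMg⟩ := h.choose_spec
  rw [turn, dif_pos h]
  set M := h.choose
  have hdisc : ∀ t, ∃ n : ℤ, M t - L t = n * (2 * Real.pi * Complex.I) := fun t => by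
    obtain ⟨n, hn⟩ := Complex.exp_eq_exp_iff_exists_int.1 ((hMg t).trans (hg t).symm)
    exact ⟨n, by rw [hn]; ring⟩
  choose n hn using hdisc
  have hn' : ∀ t, (n t : ℝ) = (M t - L t).im / (2 * Real.pi) := fun t => by
    rw [hn t]
    simp
  have hc : Continuous fun t => (n t : ℝ) := by
    simp_rw [hn']
    fun_prop
  have hci : Continuous n := Int.isClosedEmbedding_coe_real.isEmbedding.continuous_iff.2 hc
  have h01 : n 1 = n 0 := PreconnectedSpace.constant inferInstance hci
  have : M 1 - L 1 = M 0 - L 0 := by rw [hn, hn, h01]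
  rw [show M 1 - M 0 = L 1 - L 0 by linear_combination this]

theorem turn_neg {g : ℝ → ℂ} (hg : Continuous g) (h0 : ∀ t, g t ≠ 0) :
    turn (fun t => -g t) = turn g := by
  obtain ⟨L, hL, h⟩ := exists_continuous_log hg h0
  rw [turn_eq hL h, turn_eq (L := fun t => L t + Real.pi * Complex.I) (by fun_prop)]
  · simp
  · intro t
    rw [Complex.exp_add, Complex.exp_pi_mul_I, h]
    ring

/-- At each end the imaginary part of a logarithm is an argument, so it is known up to a multiple of
`2π`. -/
theorem exists_turn_eq {g : ℝ → ℂ} (hg : Continuous g) (h0 : ∀ t, g t ≠ 0) {a b : ℝ}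
    (ha : g 0 = ‖g 0‖ * Complex.exp (a * Complex.I))
    (hb : g 1 = ‖g 1‖ * Complex.exp (b * Complex.I)) :
    ∃ n : ℤ, turn g = b - a + n * (2 * Real.pi) := by
  obtain ⟨L, hL, h⟩ := exists_continuous_log hg h0
  have key : ∀ t a, g t = ‖g t‖ * Complex.exp (a * Complex.I) → ∀ a' : ℝ, (a : ℂ) = a' →
      ∃ n : ℤ, (L t).im = a' + n * (2 * Real.pi) := by
    intro t a ht a' haa
    have hpos : 0 < ‖g t‖ := norm_pos_iff.2 (h0 t)
    rw [← h t] at ht hpos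
    have : Complex.exp (L t) = Complex.exp (Real.log ‖Complex.exp (L t)‖ + a' * Complex.I) := by
      rw [Complex.exp_add, ← Complex.ofReal_exp, Real.exp_log hpos, ← haa]
      exact ht
    obtain ⟨n, hn⟩ := Complex.exp_eq_exp_iff_exists_int.1 this
    refine ⟨n, ?_⟩
    rw [hn]
    simp
  obtain ⟨m, hm⟩ := key 0 a ha a rfl
  obtain ⟨n, hn⟩ := key 1 b hb b rfl
  refine ⟨n - m, ?_⟩
  rw [turn_eq hL h, Complex.sub_im, hm, hn]
  push_cast
  ring

/-- The plane is simply connected, so `H` has a global logarithm, and both sides are its increment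
from `(0, 0)` to `(1, 1)`. -/
theorem turn_square {H : ℝ × ℝ → ℂ} (hH : Continuous H) (h0 : ∀ x, H x ≠ 0) :
    turn (fun s => H (s, 0)) + turn (fun t => H (1, t)) =
      turn (fun t => H (0, t)) + turn (fun s => H (s, 1)) := by
  obtain ⟨L, hL, h⟩ := exists_continuous_log hH h0
  rw [turn_eq (L := fun s => L (s, 0)) (by fun_prop) (fun t => h _),
    turn_eq (L := fun t => L (1, t)) (by fun_prop) (fun t => h _),
    turn_eq (L := fun t => L (0, t)) (by fun_prop) (fun t => h _),
    turn_eq (L := fun s => L (s, 1)) (by fun_prop) (fun t => h _)]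
  simp only [Complex.sub_im]
  ring

/-- The van Kampen obstruction of the complete graph on five vertices: the paths `e u v` that
represent its edges in the plane cannot all be disjoint for disjoint edges. -/
theorem exists_crossing_of_five_points (P : Fin 5 → ℂ) (e : Fin 5 → Fin 5 → ℝ → ℂ)
    (hc : ∀ u v, Continuous (e u v)) (h0 : ∀ u v, u ≠ v → e u v 0 = P u)
    (h1 : ∀ u v, u ≠ v → e u v 1 = P v)
    (hne : ∀ u v w, u ≠ v → w ≠ u → w ≠ v → ∀ t, e u v t ≠ P w) :
    ∃ u v w x, u < v ∧ w < x ∧ u ≠ w ∧ u ≠ x ∧ v ≠ w ∧ v ≠ x ∧ ∃ s t, e u v s = e w x t := by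
  by_contra! hcon
  -- An argument of `P u - P w`, normalized so that reversing the difference changes it by exactly
  -- `π` with a known sign, not merely modulo `2π`.
  let α : Fin 5 → Fin 5 → ℝ := fun w u =>
    if w < u then (P u - P w).arg else (P w - P u).arg + Real.pi
  have hα : ∀ w u, P u - P w = ‖P u - P w‖ * Complex.exp (α w u * Complex.I) := by
    intro w u
    simp only [α]
    split_ifs with h
    · exact (Complex.norm_mul_exp_arg_mul_I _).symm
    · rw [norm_sub_rev]
      push_cast
      rw [add_mul, Complex.exp_add, Complex.exp_pi_mul_I, ← mul_assoc,
        Complex.norm_mul_exp_arg_mul_I]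
      ring
  let σ : Fin 5 → Fin 5 → ℤ := fun a b => if a < b then -1 else 1
  have hσ : ∀ a b, a ≠ b → α a b - α b a = σ a b * Real.pi := by
    intro a b hab
    rcases lt_or_gt_of_ne hab with h | h
    · simp [α, σ, h, h.not_gt]
    · simp [α, σ, h, h.not_gt]
  have hk : ∀ w u v, ∃ k : ℤ, u ≠ v → w ≠ u → w ≠ v →
      turn (fun t => e u v t - P w) = α w v - α w u + k * (2 * Real.pi) := by
    intro w u v
    by_cases h : u ≠ v ∧ w ≠ u ∧ w ≠ v
    · obtain ⟨n, hn⟩ := exists_turn_eq (g := fun t => e u v t - P w)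
        ((hc u v).sub continuous_const) (fun t => sub_ne_zero.2 (hne u v w h.1 h.2.1 h.2.2 t))
        (a := α w u) (b := α w v) (by rw [h0 u v h.1]; exact hα w u)
        (by rw [h1 u v h.1]; exact hα w v)
      exact ⟨n, fun _ _ _ => hn⟩
    · exact ⟨0, fun a b c => absurd ⟨a, b, c⟩ h⟩
  choose k hk using hk
  -- On each side of the square one of the two edges stands still at a vertex. The arguments `α` at
  -- the corners combine to the four signs; the integers `k` record the full turns.
  have main : ∀ u v w x, u < v → w < x → u ≠ w → u ≠ x → v ≠ w → v ≠ x →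
      σ w v + σ u w + σ v x + σ x u +
        2 * (k w u v - k x u v + k v w x - k u w x) = 0 := by
    intro u v w x huv hwx h1' h2 h3 h4
    have hsq := turn_square (H := fun p => e u v p.1 - e w x p.2)
      (((hc u v).comp continuous_fst).sub ((hc w x).comp continuous_snd))
      (fun p => sub_ne_zero.2 (hcon u v w x huv hwx h1' h2 h3 h4 p.1 p.2))
    simp only [h0 u v huv.ne, h1 u v huv.ne, h0 w x hwx.ne, h1 w x hwx.ne] at hsq
    have hflip : ∀ y, y ≠ w → y ≠ x →
        turn (fun t => P y - e w x t) = turn (fun t => e w x t - P y) := by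
      intro y hyw hyx
      rw [← turn_neg (g := fun t => e w x t - P y) ((hc w x).sub continuous_const)
        (fun t => sub_ne_zero.2 (hne w x y hwx.ne hyw hyx t))]
      simp
    rw [hflip v h3 h4, hflip u h1' h2, hk w u v huv.ne h1'.symm h3.symm,
      hk v w x hwx.ne h3 h4, hk u w x hwx.ne h1' h2, hk x u v huv.ne h2.symm h4.symm] at hsq
    have e1 := hσ w v h3.symm
    have e2 := hσ u w h1'
    have e3 := hσ v x h4
    have e4 := hσ x u h2.symm
    have hpi : ((σ w v + σ u w + σ v x + σ x u +
        2 * (k w u v - k x u v + k v w x - k u w x) : ℤ) : ℝ) * Real.pi = 0 := by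
      push_cast
      linear_combination hsq - e1 - e2 - e3 - e4
    exact_mod_cast (mul_eq_zero.1 hpi).resolve_right Real.pi_ne_zero
  -- Halve the 15 equations and add them modulo 2. Each `k w u v` occurs twice, once for each choice
  -- of the remaining end of the edge at `w`, and cancels. The signs give -1 for interleaved pairs
  -- and 0 otherwise, and each of the five 4-subsets has exactly one interleaved pairing: the total
  -- is odd.
  have m1 := main 0 1 2 3
  have m2 := main 0 2 1 3
  have m3 := main 0 3 1 2
  have m4 := main 0 1 2 4
  have m5 := main 0 2 1 4
  have m6 := main 0 4 1 2
  have m7 := main 0 1 3 4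
  have m8 := main 0 3 1 4
  have m9 := main 0 4 1 3
  have m10 := main 0 2 3 4
  have m11 := main 0 3 2 4
  have m12 := main 0 4 2 3
  have m13 := main 1 2 3 4
  have m14 := main 1 3 2 4
  have m15 := main 1 4 2 3
  simp [σ] at m1 m2 m3 m4 m5 m6 m7 m8 m9 m10 m11 m12 m13 m14 m15
  clear main
  omega

/-! Crossings of disjoint edges of a complete graph -/

section Crossings

variable {V : Type*} [DecidableEq V]

theorem lineMap_vertexPoint_apply (u v x : V) (t : ℝ) :
    (AffineMap.lineMap (vertexPoint u) (vertexPoint v) t : V → ℝ) x =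
      (1 - t) * (if x = u then 1 else 0) + t * (if x = v then 1 else 0) := by
  simp [AffineMap.lineMap_apply_module, vertexPoint, Pi.single_apply]

theorem exists_eq_lineMap_of_mem_segment {u v : V} {p : V → ℝ}
    (h : p ∈ segment ℝ (vertexPoint u) (vertexPoint v)) :
    ∃ t ∈ Set.Icc (0 : ℝ) 1, p = AffineMap.lineMap (vertexPoint u) (vertexPoint v) t := by
  rw [segment_eq_image_lineMap] at h
  obtain ⟨t, ht, rfl⟩ := h
  exact ⟨t, ht, rfl⟩

theorem segment_subset_space_top (u v : V) : segment ℝ (vertexPoint u) (vertexPoint v) ⊆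
    space (⊤ : (⊤ : SimpleGraph V).Subgraph) := by
  intro p hp
  by_cases h : u = v
  · subst h
    rw [segment_same] at hp
    exact Or.inl ⟨u, trivial, hp⟩
  · exact Or.inr ⟨u, v, h, hp⟩

/-- The edges `uv` and `wx` are disjoint, and their images under `f` meet. -/
def Crosses (f : space (⊤ : (⊤ : SimpleGraph V).Subgraph) → Plane) (u v w x : V) : Prop :=
  [u, v, w, x].Nodup ∧ ∃ p q, f p = f q ∧ (p : V → ℝ) ∈ segment ℝ (vertexPoint u) (vertexPoint v) ∧
    (q : V → ℝ) ∈ segment ℝ (vertexPoint w) (vertexPoint x)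

variable {f : space (⊤ : (⊤ : SimpleGraph V).Subgraph) → Plane} {u v w x : V}

theorem Crosses.symm (h : Crosses f u v w x) : Crosses f w x u v := by
  obtain ⟨hn, p, q, e, hp, hq⟩ := h
  refine ⟨?_, q, p, e.symm, hq, hp⟩
  simp at hn ⊢
  tauto

theorem Crosses.swap (h : Crosses f u v w x) : Crosses f v u w x := by
  obtain ⟨hn, p, q, e, hp, hq⟩ := h
  refine ⟨?_, p, q, e, segment_symm ℝ (vertexPoint u) (vertexPoint v) ▸ hp, hq⟩
  simp at hn ⊢
  tauto

/-- Genericity supplies the hypothesis that no edge meets a third vertex: the image of that vertex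
would be a multiple point. -/
theorem exists_crosses (hf : IsGenericImmersion (⊤ : (⊤ : SimpleGraph V).Subgraph) f)
    (s : Finset V) (hs : 5 ≤ s.card) :
    ∃ u ∈ s, ∃ v ∈ s, ∃ w ∈ s, ∃ x ∈ s, Crosses f u v w x := by
  obtain ⟨s', hs', hcard⟩ := Finset.exists_subset_card_eq hs
  let i : Fin 5 → V := fun k => (s'.equivFinOfCardEq hcard).symm k
  have hi : Function.Injective i :=
    Subtype.val_injective.comp (s'.equivFinOfCardEq hcard).symm.injective
  have his : ∀ k, i k ∈ s := fun k => hs' (Subtype.prop _)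
  let toC : Plane → ℂ := fun p => ⟨p 0, p 1⟩
  have htoC : Continuous toC := by
    have : toC = fun p => (p 0 : ℂ) + p 1 * Complex.I := by
      ext p
      exact Complex.mk_eq_add_mul_I _ _
    rw [this]
    fun_prop
  have htoCinj : Function.Injective toC := by
    intro p q h
    simp only [toC, Complex.mk.injEq] at h
    ext k
    fin_cases k
    exacts [h.1, h.2]
  let pt : V → V → ℝ → space (⊤ : (⊤ : SimpleGraph V).Subgraph) := fun u v t =>
    ⟨AffineMap.lineMap (vertexPoint u) (vertexPoint v) (Set.projIcc 0 1 zero_le_one t : ℝ),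
      segment_subset_space_top u v (by
        rw [segment_eq_image_lineMap]
        exact ⟨_, Subtype.prop _, rfl⟩)⟩
  have hptc : ∀ u v, Continuous (pt u v) := fun u v => by
    refine Continuous.subtype_mk ?_ _
    have : Continuous fun t : ℝ => (Set.projIcc (0 : ℝ) 1 zero_le_one t : ℝ) :=
      continuous_subtype_val.comp continuous_projIcc
    exact AffineMap.lineMap_continuous.comp this
  have hptseg : ∀ u v t, (pt u v t : V → ℝ) ∈ segment ℝ (vertexPoint u) (vertexPoint v) := by
    intro u v t
    rw [segment_eq_image_lineMap]
    exact ⟨_, Subtype.prop _, rfl⟩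
  let vp : V → space (⊤ : (⊤ : SimpleGraph V).Subgraph) := fun v =>
    ⟨vertexPoint v, Or.inl ⟨v, trivial, rfl⟩⟩
  obtain ⟨a, b, c, d, hab, hcd, hac, had, hbc, hbd, t, t', he⟩ :=
    exists_crossing_of_five_points (fun k => toC (f (vp (i k))))
      (fun a b t => toC (f (pt (i a) (i b) t)))
      (fun a b => htoC.comp (hf.continuous.comp (hptc _ _)))
      (fun a b _ => by
        congr 2
        ext1
        simp [pt, vp])
      (fun a b _ => by
        congr 2
        ext1
        simp [pt, vp])
      (fun a b c hab hca hcb t h => by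
        have h' := htoCinj h
        have hne : vp (i c) ≠ pt (i a) (i b) t := by
          intro h2
          have h3 := congrFun (congrArg Subtype.val h2) (i c)
          simp only [vp, pt] at h3
          rw [lineMap_vertexPoint_apply, if_neg (hi.ne hca), if_neg (hi.ne hcb)] at h3
          simp [vertexPoint] at h3
        exact hf.interior _ _ hne h'.symm (i c) rfl)
  refine ⟨_, his a, _, his b, _, his c, _, his d, ?_, _, _, htoCinj he, hptseg _ _ _,
    hptseg _ _ _⟩
  simp [hi.eq_iff, hab.ne, hcd.ne, hac, had, hbc, hbd]

end Crossings

/-! ### Choosing the crossing edges greedily, with one borrowed vertex -/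

section Arrangement

variable {V : Type*} [DecidableEq V] {f : space (⊤ : (⊤ : SimpleGraph V).Subgraph) → Plane}
  {ι : Type*} [DecidableEq ι] {τ : ι → ι}

/-- Disjoint edges `g i false`, `g i true` such that the edges at `i` and at `τ i` cross can be
chosen greedily, as long as five vertices are left for each choice. -/
theorem exists_crossing_assignment
    (hf : IsGenericImmersion (⊤ : (⊤ : SimpleGraph V).Subgraph) f)
    (hτ : Function.Involutive τ) (hτ' : ∀ i, τ i ≠ i) (A : Finset V) (S : Finset ι)
    (hS : ∀ i ∈ S, τ i ∈ S) (hA : 2 * S.card + 1 ≤ A.card) :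
    ∃ g : ι × Bool → V, Set.InjOn g (S ×ˢ Finset.univ : Finset (ι × Bool)) ∧
      ∀ i ∈ S, Crosses f (g (i, false)) (g (i, true)) (g (τ i, false)) (g (τ i, true)) := by
  induction S using Finset.strongInduction with
  | H S ih =>
  rcases S.eq_empty_or_nonempty with rfl | ⟨i, hi⟩
  · obtain ⟨a, -⟩ : A.Nonempty := Finset.card_pos.1 (by omega)
    exact ⟨fun _ => a, by simp, by simp⟩
  · set S' := (S.erase i).erase (τ i) with hS'
    have hti : τ i ∈ S.erase i := Finset.mem_erase.2 ⟨hτ' i, hS i hi⟩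
    have hcard : S'.card + 2 = S.card := by
      rw [hS', ← Finset.card_erase_add_one hi, ← Finset.card_erase_add_one hti]
    have hmem : ∀ j, j ∈ S' ↔ j ≠ τ i ∧ j ≠ i ∧ j ∈ S := fun j => by
      simp [hS', Finset.mem_erase]
    obtain ⟨g, hg, hgc⟩ := ih S' (((Finset.erase_subset _ _).trans_ssubset
      (Finset.erase_ssubset hi))) (fun j hj => by
        rw [hmem] at hj ⊢
        exact ⟨fun h => hj.2.1 (hτ.injective h), fun h => hj.1 (by rw [← h, hτ]), hS j hj.2.2⟩)
        (by omega)
    set U := (S' ×ˢ (Finset.univ : Finset Bool)).image g with hU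
    have hUcard : U.card ≤ 2 * S'.card := by
      refine Finset.card_image_le.trans ?_
      rw [Finset.card_product]
      simp [mul_comm]
    -- `U` has at most `2 * S'.card` vertices, and `A` at least `2 * S'.card + 5`.
    obtain ⟨u, hu, v, hv, w, hw, x, hx, hcr⟩ := exists_crosses hf (A \ U) (by
      have := Finset.le_card_sdiff U A
      omega)
    have hout : ∀ y ∈ A \ U, ∀ j ∈ S', ∀ c, g (j, c) ≠ y := by
      rintro y hy j hj c rfl
      refine (Finset.mem_sdiff.1 hy).2 (Finset.mem_image_of_mem g ?_)
      simp [hj]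
    have hnd := hcr.1
    simp only [List.nodup_cons, List.mem_cons, List.not_mem_nil, or_false, not_or] at hnd
    let g' : ι × Bool → V := fun p =>
      if p.1 = i then (if p.2 then v else u) else if p.1 = τ i then (if p.2 then x else w) else g p
    have hti' := hτ' i
    refine ⟨g', ?_, ?_⟩
    · have hou := hout u hu
      have hov := hout v hv
      have how := hout w hw
      have hox := hout x hx
      rintro ⟨j, c⟩ hj ⟨k, d⟩ hk h
      have hj' : j ∈ S := by simpa using hj
      have hk' : k ∈ S := by simpa using hk
      have hjS := hmem j
      have hkS := hmem k
      have hinj : j ∈ S' → k ∈ S' → g (j, c) = g (k, d) → j = k ∧ c = d := fun a b e => by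
        simpa using hg (by simpa using a) (by simpa using b) e
      have hou1 := hou j
      have hov1 := hov j
      have how1 := how j
      have hox1 := hox j
      have hou2 := hou k
      have hov2 := hov k
      have how2 := how k
      have hox2 := hox k
      clear hou hov how hox hout hg hgc ih hmem hS
      simp only [g'] at h
      rw [Prod.mk.injEq]
      cases c <;> cases d <;> grind
    · intro j hj
      by_cases hji : j = i
      · subst hji
        simpa [g', hti'] using hcr
      · by_cases hjt : j = τ i
        · subst hjt
          simpa [g', hti', hτ i] using hcr.symm
        · have h1 : τ j ≠ i := fun h => hjt (by rw [← h, hτ])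
          have h2 : τ j ≠ τ i := fun h => hji (hτ.injective h)
          simpa [g', hji, hjt, h1, h2] using hgc j ((hmem j).2 ⟨hjt, hji, hj⟩)

/-- All the vertices can be arranged in pairs `w i false`, `w i true` such that the edges at `i` and
at `τ i` cross, where for one `i₁` the edge at `i₁` possibly has to be replaced by the edge that
connects the edge at a given `i₀` with it. -/
theorem exists_vertex_arrangement [Fintype V] [Fintype ι]
    (hf : IsGenericImmersion (⊤ : (⊤ : SimpleGraph V).Subgraph) f)
    (hτ : Function.Involutive τ) (hτ' : ∀ i, τ i ≠ i) (hcard : Fintype.card V = 2 * Fintype.card ι)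
    {i₀ i₁ : ι} (h01 : i₀ ≠ i₁) (hτ01 : τ i₀ ≠ i₁) :
    ∃ w : ι × Bool → V, Function.Injective w ∧
      (∀ i, i ≠ i₁ → i ≠ τ i₁ →
        Crosses f (w (i, false)) (w (i, true)) (w (τ i, false)) (w (τ i, true))) ∧
      (Crosses f (w (i₁, false)) (w (i₁, true)) (w (τ i₁, false)) (w (τ i₁, true)) ∨
        Crosses f (w (i₀, true)) (w (i₁, false)) (w (τ i₁, false)) (w (τ i₁, true))) := by
  set S : Finset ι := (Finset.univ.erase i₁).erase (τ i₁) with hS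
  have hti : τ i₁ ∈ (Finset.univ : Finset ι).erase i₁ :=
    Finset.mem_erase.2 ⟨hτ' i₁, Finset.mem_univ _⟩
  have hScard : S.card + 2 = Fintype.card ι := by
    rw [← Finset.card_univ, hS, ← Finset.card_erase_add_one (Finset.mem_univ i₁),
      ← Finset.card_erase_add_one hti]
  have hmem : ∀ j, j ∈ S ↔ j ≠ τ i₁ ∧ j ≠ i₁ := fun j => by simp [hS, Finset.mem_erase]
  obtain ⟨g, hg, hgc⟩ := exists_crossing_assignment hf hτ hτ' Finset.univ S (fun j hj => by
      rw [hmem] at hj ⊢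
      exact ⟨fun h => hj.2 (hτ.injective h), fun h => hj.1 (by rw [← h, hτ])⟩)
    (by rw [Finset.card_univ]; omega)
  set U := (S ×ˢ (Finset.univ : Finset Bool)).image g with hU
  have hUcard : U.card = 2 * S.card := by
    rw [hU, Finset.card_image_of_injOn hg, Finset.card_product]
    simp [mul_comm]
  have hRcard : Uᶜ.card = 4 := by
    rw [Finset.card_compl]
    omega
  have hgU : ∀ j ∈ S, ∀ c, g (j, c) ∈ U := fun j hj c =>
    Finset.mem_image_of_mem g (by simp [hj])
  have hi₀ : i₀ ∈ S := (hmem _).2 ⟨fun h => hτ01 (by rw [h, hτ]), h01⟩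
  have ha : g (i₀, true) ∉ Uᶜ := by simpa using hgU i₀ hi₀ true
  -- The borrowed vertex completes the four free ones to five; by the symmetries of `Crosses` it may
  -- be taken to be `u` if it occurs at all.
  obtain ⟨u, v, w, x, hu, hv, hw, hx, hcr⟩ : ∃ u v w x, (u ∈ Uᶜ ∨ u = g (i₀, true)) ∧ v ∈ Uᶜ ∧
      w ∈ Uᶜ ∧ x ∈ Uᶜ ∧ Crosses f u v w x := by
    obtain ⟨u, hu, v, hv, w, hw, x, hx, hcr⟩ := exists_crosses hf (insert (g (i₀, true)) Uᶜ) (by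
      rw [Finset.card_insert_of_notMem ha]
      omega)
    have hnd := hcr.1
    simp only [List.nodup_cons, List.mem_cons, List.not_mem_nil, or_false, not_or] at hnd
    rw [Finset.mem_insert] at hu hv hw hx
    by_cases h1 : v = g (i₀, true)
    · exact ⟨v, u, w, x, by grind, by grind, by grind, by grind, hcr.swap⟩
    by_cases h2 : w = g (i₀, true)
    · exact ⟨w, x, u, v, by grind, by grind, by grind, by grind, hcr.symm⟩
    by_cases h3 : x = g (i₀, true)
    · exact ⟨x, w, u, v, by grind, by grind, by grind, by grind, hcr.symm.swap⟩
    exact ⟨u, v, w, x, by grind, by grind, by grind, by grind, hcr⟩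
  have hnd := hcr.1
  simp only [List.nodup_cons, List.mem_cons, List.not_mem_nil, or_false, not_or] at hnd
  have hti' := hτ' i₁
  obtain ⟨p, q, hp, hq, hpq, hpn, hqn, hor⟩ : ∃ p q, p ∈ Uᶜ ∧ q ∈ Uᶜ ∧ p ≠ q ∧
      (p ≠ w ∧ p ≠ x) ∧ (q ≠ w ∧ q ≠ x) ∧ (Crosses f p q w x ∨ Crosses f (g (i₀, true)) p w x) := by
    rcases hu with hu | rfl
    · exact ⟨u, v, hu, hv, by tauto, by tauto, by tauto, Or.inl hcr⟩
    -- The crossing used only three free vertices; the fourth fills the place `(i₁, true)`, so that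
    -- all vertices stay in use.
    · obtain ⟨y, hy⟩ : (((Uᶜ.erase v).erase w).erase x).Nonempty := by
        rw [← Finset.card_pos]
        have h1 := Finset.pred_card_le_card_erase (s := Uᶜ) (a := v)
        have h2 := Finset.pred_card_le_card_erase (s := Uᶜ.erase v) (a := w)
        have h3 := Finset.pred_card_le_card_erase (s := (Uᶜ.erase v).erase w) (a := x)
        omega
      simp only [Finset.mem_erase] at hy
      exact ⟨v, y, hv, hy.2.2.2, hy.2.2.1.symm, by tauto, by tauto, Or.inr hcr⟩
  let g' : ι × Bool → V := fun k =>
    if k.1 = i₁ then (if k.2 then q else p) else if k.1 = τ i₁ then (if k.2 then x else w) else g k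
  have hi₀' := (hmem i₀).1 hi₀
  refine ⟨g', ?_, ?_, ?_⟩
  · rintro ⟨j, c⟩ ⟨k, d⟩ h
    have hjS := hmem j
    have hkS := hmem k
    have hinj : j ∈ S → k ∈ S → g (j, c) = g (k, d) → j = k ∧ c = d := fun a b e => by
      simpa using hg (by simpa using a) (by simpa using b) e
    have hj := hgU j
    have hk := hgU k
    rw [Finset.mem_compl] at hp hq hw hx
    clear hgU hg hgc hmem hor hcr hu hv
    simp only [g'] at h
    rw [Prod.mk.injEq]
    cases c <;> cases d <;> grind
  · intro j hj1 hjt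
    have h1 : τ j ≠ i₁ := fun h => hjt (by rw [← h, hτ])
    have h2 : τ j ≠ τ i₁ := fun h => hj1 (hτ.injective h)
    simpa [g', hj1, hjt, h1, h2] using hgc j ((hmem j).2 ⟨hjt, hj1⟩)
  · simpa [g', hti', hi₀'] using hor

end Arrangement

/-! Parametrizations of circles -/

theorem exists_continuous_strictMonoOn_interpolation (m : ℕ) (t x : ℕ → ℝ)
    (ht : ∀ i < m, t i < t (i + 1)) (hx : ∀ i < m, x i < x (i + 1)) :
    ∃ F : ℝ → ℝ, Continuous F ∧ StrictMonoOn F (Set.Icc (t 0) (t m)) ∧ ∀ i ≤ m, F (t i) = x i := by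
  induction m with
  | zero =>
    refine ⟨fun _ => x 0, continuous_const, ?_, fun i hi => by rw [Nat.le_zero.1 hi]⟩
    intro a ha b hb hab
    exact absurd (ha.1.trans_lt (hab.trans_le hb.2)) (lt_irrefl _)
  | succ m ih =>
    obtain ⟨F, hF, hmono, hval⟩ := ih (fun i hi => ht i (by omega)) (fun i hi => hx i (by omega))
    have htm := ht m (by omega)
    have hxm := hx m (by omega)
    have hle : ∀ i ≤ m, t i ≤ t m := fun i hi =>
      Nat.decreasingInduction' (P := fun k => t k ≤ t m)
        (fun k hk _ h => (ht k (by omega)).le.trans h) hi le_rfl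
    have hslope : 0 < (x (m + 1) - x m) / (t (m + 1) - t m) :=
      div_pos (sub_pos.2 hxm) (sub_pos.2 htm)
    set c := (x (m + 1) - x m) / (t (m + 1) - t m) with hc
    -- Freeze the old function beyond `t m` and continue it there with the slope `c` of the new
    -- piece.
    refine ⟨fun s => F (min s (t m)) + c * max 0 (s - t m), by fun_prop, ?_, ?_⟩
    · intro a ha b hb hab
      have h0 : min a (t m) ≤ min b (t m) := min_le_min_right _ hab.le
      have hmin : ∀ s ∈ Set.Icc (t 0) (t (m + 1)), min s (t m) ∈ Set.Icc (t 0) (t m) := fun s hs =>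
        ⟨le_min hs.1 (hle 0 (Nat.zero_le _)), min_le_right _ _⟩
      have h1 := hmono.monotoneOn (hmin a ha) (hmin b hb) h0
      have h2 : max 0 (a - t m) ≤ max 0 (b - t m) := max_le_max_left _ (by linarith)
      rcases lt_or_ge a (t m) with h | h
      · have h3 : F (min a (t m)) < F (min b (t m)) := by
          refine hmono (hmin a ha) (hmin b hb) ?_
          rw [min_eq_left h.le]
          exact lt_min hab h
        exact add_lt_add_of_lt_of_le h3 (mul_le_mul_of_nonneg_left h2 hslope.le)
      · have h3 : max 0 (a - t m) < max 0 (b - t m) := by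
          rw [max_eq_right (by linarith), max_eq_right (by linarith)]
          linarith
        exact add_lt_add_of_le_of_lt h1 (mul_lt_mul_of_pos_left h3 hslope)
    · intro i hi
      rcases Nat.lt_or_eq_of_le hi with h | rfl
      · have h' := hle i (by omega)
        simp only
        rw [min_eq_left h', max_eq_left (by linarith), hval i (by omega)]
        ring
      · simp only
        rw [min_eq_right htm.le, max_eq_right (by linarith), hval m le_rfl, hc,
          div_mul_cancel₀ _ (sub_pos.2 htm).ne']
        ring

/-- A closed path descends to the circle; there it is a continuous bijection from a compact space to
a Hausdorff one. -/
theorem exists_circle_homeomorph {Y : Type*} [TopologicalSpace Y] [T2Space Y] {r : ℝ → Y}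
    (hr : ContinuousOn r (Set.Icc 0 1)) (h01 : r 0 = r 1) (hinj : Set.InjOn r (Set.Ico 0 1))
    (hsurj : ∀ y, ∃ t ∈ Set.Ico (0 : ℝ) 1, r t = y) :
    ∃ P : Circle ≃ₜ Y, ∀ t ∈ Set.Ico (0 : ℝ) 1, P (Circle.exp (2 * Real.pi * t)) = r t := by
  have hval : ∀ t ∈ Set.Ico (0 : ℝ) 1, AddCircle.liftIco 1 0 r (t : AddCircle (1 : ℝ)) = r t :=
    fun t ht => AddCircle.liftIco_zero_coe_apply ht
  have hrep : ∀ y : AddCircle (1 : ℝ), ∃ t ∈ Set.Ico (0 : ℝ) 1, (t : AddCircle (1 : ℝ)) = y := by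
    intro y
    obtain ⟨t, ht, h⟩ := AddCircle.coe_image_Ico_eq (1 : ℝ) 0 ▸ Set.mem_univ y
    exact ⟨t, by simpa using ht, h⟩
  have hbij : Function.Bijective (AddCircle.liftIco 1 0 r) := by
    constructor
    · intro y y' h
      obtain ⟨t, ht, rfl⟩ := hrep y
      obtain ⟨t', ht', rfl⟩ := hrep y'
      rw [hval t ht, hval t' ht'] at h
      rw [hinj ht ht' h]
    · intro y
      obtain ⟨t, ht, rfl⟩ := hsurj y
      exact ⟨t, hval t ht⟩
  let Q : AddCircle (1 : ℝ) ≃ₜ Y := Continuous.homeoOfEquivCompactToT2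
    (f := Equiv.ofBijective _ hbij) (AddCircle.liftIco_zero_continuous h01 hr)
  refine ⟨(AddCircle.homeomorphCircle one_ne_zero).symm.trans Q, fun t ht => ?_⟩
  have : Circle.exp (2 * Real.pi * t) = AddCircle.homeomorphCircle one_ne_zero
      (t : AddCircle (1 : ℝ)) := by
    rw [AddCircle.homeomorphCircle_apply, AddCircle.toCircle_apply_mk, div_one]
  rw [this, Homeomorph.trans_apply, Homeomorph.symm_apply_apply]
  exact hval t ht

/-- The image of a chord diagram under an injective map. -/
def ChordDiagram.map {S T : Type*} (C : ChordDiagram S) (g : S → T) (hg : Function.Injective g) :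
    ChordDiagram T where
  chords := Sym2.map g '' C.chords
  finite := C.finite.image _
  not_isDiag := by
    rintro _ ⟨z, hz, rfl⟩
    rw [Sym2.isDiag_map hg]
    exact C.not_isDiag z hz
  eq_of_mem := by
    rintro _ ⟨z, hz, rfl⟩ _ ⟨w, hw, rfl⟩ x hxz hxw
    rw [Sym2.mem_map] at hxz hxw
    obtain ⟨a, ha, rfl⟩ := hxz
    obtain ⟨b, hb, hab⟩ := hxw
    rw [C.eq_of_mem z hz w hw a ha (hg hab ▸ hb)]

/-- The endpoints of an `n`-chord diagram on the unit circle, numbered counterclockwise. -/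
theorem ChordDiagram.exists_enumeration {n : ℕ} (C : ChordDiagram Circle) (hC : C.size = n) :
    ∃ (b : Circle) (t : Fin (2 * n) → ℝ) (τ : Fin (2 * n) → Fin (2 * n)), StrictMono t ∧
      (∀ i, t i ∈ Set.Ioo (0 : ℝ) 1) ∧ Function.Involutive τ ∧ (∀ i, τ i ≠ i) ∧
      C.chords = {z | ∃ i, z = s(b * Circle.exp (2 * Real.pi * t i),
        b * Circle.exp (2 * Real.pi * t (τ i)))} := by
  classical
  set E : Finset Circle := C.finite.toFinset.biUnion Sym2.toFinset with hE
  have hmemE : ∀ x, x ∈ E ↔ ∃ z ∈ C.chords, x ∈ z := by simp [hE]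
  have hEcard : E.card = 2 * n := by
    rw [hE, Finset.card_biUnion, Finset.sum_congr rfl (g := fun _ => 2), Finset.sum_const,
      ← Set.ncard_eq_toFinset_card C.chords C.finite, smul_eq_mul, mul_comm]
    · exact congrArg _ hC
    · intro z hz
      exact Sym2.card_toFinset_of_not_isDiag z (C.not_isDiag z (by simpa using hz))
    · intro z hz w hw hzw
      rw [Function.onFun, Finset.disjoint_left]
      intro x hx hx'
      exact hzw (C.eq_of_mem z (by simpa using hz) w (by simpa using hw) x (by simpa using hx)
        (by simpa using hx'))
  have hIco : Infinite (Set.Ico (0 : ℝ) (0 + 1)) := (Set.Ico_infinite (by norm_num)).to_subtype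
  have hinf : Infinite Circle :=
    ((AddCircle.equivIco (1 : ℝ) 0).symm.trans
      (AddCircle.homeomorphCircle (T := (1 : ℝ)) one_ne_zero).toEquiv).infinite_iff.1 hIco
  -- Cutting the circle at a point that is no endpoint keeps all the angles strictly inside `(0,
  -- 1)`.
  obtain ⟨b, hb⟩ := Infinite.exists_notMem_finset E
  have hpi := Real.pi_pos
  let θ : Circle → ℝ := fun z => Int.fract (((z / b : Circle) : ℂ).arg / (2 * Real.pi))
  have hθ : ∀ z, b * Circle.exp (2 * Real.pi * θ z) = z := by
    intro z
    have : 2 * Real.pi * θ z = ((z / b : Circle) : ℂ).arg -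
        (⌊((z / b : Circle) : ℂ).arg / (2 * Real.pi)⌋ : ℤ) * (2 * Real.pi) := by
      simp only [θ, Int.fract]
      field_simp
    rw [this, Circle.exp_sub, Circle.exp_int_mul_two_pi, Circle.exp_arg]
    simp
  have hθinj : Function.Injective θ := fun z z' h => by rw [← hθ z, ← hθ z', h]
  have hθIoo : ∀ z ∈ E, θ z ∈ Set.Ioo (0 : ℝ) 1 := by
    intro z hz
    refine ⟨lt_of_le_of_ne (Int.fract_nonneg _) fun h => ?_, Int.fract_lt_one _⟩
    have := hθ z
    rw [← h] at this
    simp at this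
    exact hb (this ▸ hz)
  have hTcard : (E.image θ).card = 2 * n := by rw [Finset.card_image_of_injective _ hθinj, hEcard]
  let t := (E.image θ).orderEmbOfFin hTcard
  let c : Fin (2 * n) → Circle := fun i => b * Circle.exp (2 * Real.pi * t i)
  have ht : ∀ i, ∃ z ∈ E, θ z = t i := fun i =>
    Finset.mem_image.1 ((E.image θ).orderEmbOfFin_mem hTcard i)
  have hcθ : ∀ i z, θ z = t i → c i = z := fun i z h => by
    simp only [c]
    rw [← h, hθ]
  have hcE : ∀ i, c i ∈ E ∧ θ (c i) = t i := fun i => by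
    obtain ⟨z, hz, h⟩ := ht i
    rw [hcθ i z h]
    exact ⟨hz, h⟩
  have hcinj : Function.Injective c := fun i j h => t.injective (by
    rw [← (hcE i).2, ← (hcE j).2, h])
  have hcsurj : ∀ z ∈ E, ∃ i, c i = z := fun z hz => by
    have : θ z ∈ Set.range t := by
      rw [Finset.range_orderEmbOfFin]
      exact Finset.mem_coe.2 (Finset.mem_image_of_mem _ hz)
    obtain ⟨i, hi⟩ := this
    exact ⟨i, hcθ i z hi.symm⟩
  have hpartner : ∀ i, ∃ j, s(c i, c j) ∈ C.chords := fun i => by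
    obtain ⟨z, hz, hiz⟩ := (hmemE _).1 (hcE i).1
    obtain ⟨y, rfl⟩ := hiz
    obtain ⟨j, rfl⟩ := hcsurj y ((hmemE _).2 ⟨_, hz, by simp⟩)
    exact ⟨j, hz⟩
  choose τ hτ using hpartner
  have hne : ∀ i, τ i ≠ i := fun i h => C.not_isDiag _ (hτ i) (by simp [h])
  refine ⟨b, t, τ, t.strictMono, fun i => (hcE i).2 ▸ hθIoo _ (hcE i).1, fun i => ?_, hne, ?_⟩
  · have := C.eq_of_mem _ (hτ i) _ (hτ (τ i)) (c (τ i)) (by simp) (by simp)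
    rw [Sym2.eq_iff] at this
    rcases this with h | h
    · exact absurd (hcinj h.1).symm (hne i)
    · exact (hcinj h.1).symm
  · ext z
    refine ⟨fun hz => ?_, ?_⟩
    · obtain ⟨x, y, rfl⟩ : ∃ x y, z = s(x, y) := by
        induction z with | _ x y => exact ⟨x, y, rfl⟩
      obtain ⟨i, rfl⟩ := hcsurj x ((hmemE _).2 ⟨_, hz, by simp⟩)
      exact ⟨i, C.eq_of_mem _ hz _ (hτ i) (c i) (by simp) (Sym2.mem_mk_left _ _)⟩
    · rintro ⟨i, rfl⟩
      exact hτ i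

/-! Hamiltonian cycles of complete graphs -/

section HamiltonianCycle

variable {V : Type*} {N : ℕ} (e : V ≃ Fin N)

/-- The Hamiltonian cycle of the complete graph that runs through the vertices in the given cyclic
order. -/
def cycleSubgraph : (⊤ : SimpleGraph V).Subgraph where
  verts := Set.univ
  Adj a b := a ≠ b ∧ (((e a : ℕ) + 1) % N = e b ∨ ((e b : ℕ) + 1) % N = e a)
  adj_sub h := h.1
  edge_vert _ := trivial
  symm := ⟨fun _ _ h => ⟨h.1.symm, h.2.symm⟩⟩

/-- The parametrization by `[0, N]` of the Hamiltonian cycle that is affine on its edges. -/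
noncomputable def cyclePath (t : ℝ) : V → ℝ := fun v =>
  max 0 (1 - |t - (e v : ℕ)|) + max 0 (1 - |t - (e v : ℕ) - N|)

theorem continuous_cyclePath : Continuous (cyclePath e) := by
  unfold cyclePath
  fun_prop

variable {e}

theorem exists_next (e : V ≃ Fin N) (a : V) : ∃ b, ((e a : ℕ) + 1) % N = e b :=
  ⟨e.symm ⟨((e a : ℕ) + 1) % N, Nat.mod_lt _ (Nat.zero_lt_of_lt (e a).2)⟩, by simp⟩

theorem next_ne (hN : 2 ≤ N) {a b : V} (hab : ((e a : ℕ) + 1) % N = e b) : a ≠ b := by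
  rintro rfl
  have := (e a).2
  rcases Nat.lt_or_ge ((e a : ℕ) + 1) N with h | h
  · rw [Nat.mod_eq_of_lt h] at hab
    omega
  · rw [show (e a : ℕ) + 1 = N by omega, Nat.mod_self] at hab
    omega

theorem exists_eq_add (e : V ≃ Fin N) {t : ℝ} (ht : t ∈ Set.Ico (0 : ℝ) N) :
    ∃ a, ∃ s ∈ Set.Ico (0 : ℝ) 1, t = (e a : ℕ) + s := by
  have h : ⌊t⌋₊ < N := (Nat.floor_lt ht.1).2 ht.2
  refine ⟨e.symm ⟨⌊t⌋₊, h⟩, t - ⌊t⌋₊, ⟨?_, ?_⟩, ?_⟩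
  · have := Nat.floor_le ht.1
    linarith
  · have := Nat.lt_floor_add_one t
    linarith
  · simp

variable [DecidableEq V]

/-- On this interval only the tents of `a` and of its successor are nonzero, and they are the
barycentric coordinates. The tent shifted by `N` matters only on the closing edge, for the vertex in
position 0. -/
theorem cyclePath_eq (hN : 2 ≤ N) {a b : V} (hab : ((e a : ℕ) + 1) % N = e b) {s : ℝ}
    (hs : s ∈ Set.Icc (0 : ℝ) 1) :
    cyclePath e ((e a : ℕ) + s) = AffineMap.lineMap (vertexPoint a) (vertexPoint b) s := by
  obtain ⟨hs0, hs1⟩ := hs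
  have hne : b ≠ a := (next_ne hN hab).symm
  have hat0 : ∀ y : ℝ, 1 ≤ |y| → max 0 (1 - |y|) = 0 := fun y hy => max_eq_left (by linarith)
  have hat1 : ∀ y : ℝ, |y| ≤ 1 → max 0 (1 - |y|) = 1 - |y| := fun y hy =>
    max_eq_right (by linarith)
  ext v
  rw [lineMap_vertexPoint_apply]
  have ha := (e a).2
  have hv := (e v).2
  have hNr : (2 : ℝ) ≤ N := by exact_mod_cast hN
  have har : ((e a : ℕ) : ℝ) + 1 ≤ N := by exact_mod_cast ha
  have hvr : ((e v : ℕ) : ℝ) + 1 ≤ N := by exact_mod_cast hv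
  have hv0 : (0 : ℝ) ≤ (e v : ℕ) := Nat.cast_nonneg _
  have ha0 : (0 : ℝ) ≤ (e a : ℕ) := Nat.cast_nonneg _
  simp only [cyclePath]
  by_cases hva : v = a
  · subst hva
    rw [if_pos rfl, if_neg hne.symm, hat0 (_ - N) (by rw [le_abs]; right; linarith),
      hat1 _ (by rw [abs_le]; constructor <;> linarith), add_sub_cancel_left, abs_of_nonneg hs0]
    ring
  · have hva' : (e v : ℕ) ≠ e a := fun h => hva (e.injective (Fin.ext h))
    rw [if_neg hva]
    rcases Nat.lt_or_ge ((e a : ℕ) + 1) N with h | h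
    · rw [Nat.mod_eq_of_lt h] at hab
      have hr : ((e a : ℕ) : ℝ) + 1 + 1 ≤ N := by exact_mod_cast h
      rw [hat0 (_ - N) (by rw [le_abs]; right; linarith)]
      by_cases hvb : v = b
      · subst hvb
        have : ((e v : ℕ) : ℝ) = (e a : ℕ) + 1 := by exact_mod_cast hab.symm
        rw [if_pos rfl, hat1 _ (by rw [abs_le]; constructor <;> linarith),
          abs_of_nonpos (by linarith), this]
        ring
      · have hvb' : (e v : ℕ) ≠ e b := fun h => hvb (e.injective (Fin.ext h))
        rw [if_neg hvb, hat0]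
        · ring
        · rw [le_abs]
          rcases Nat.lt_or_ge (e v : ℕ) (e a) with h' | h'
          · left
            have : ((e v : ℕ) : ℝ) + 1 ≤ (e a : ℕ) := by exact_mod_cast h'
            linarith
          · right
            have : ((e a : ℕ) : ℝ) + 1 + 1 ≤ (e v : ℕ) := by
              have : (e a : ℕ) + 1 + 1 ≤ e v := by omega
              exact_mod_cast this
            linarith
    · have hNa : (e a : ℕ) + 1 = N := by omega
      rw [hNa, Nat.mod_self] at hab
      have hr : ((e a : ℕ) : ℝ) + 1 = N := by exact_mod_cast hNa
      have hva2 : ((e v : ℕ) : ℝ) + 1 ≤ (e a : ℕ) := by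
        have : (e v : ℕ) + 1 ≤ e a := by omega
        exact_mod_cast this
      rw [hat0 (_ - ((e v : ℕ) : ℝ)) (by rw [le_abs]; left; linarith)]
      by_cases hvb : v = b
      · subst hvb
        have : ((e v : ℕ) : ℝ) = 0 := by exact_mod_cast hab.symm
        rw [if_pos rfl, hat1 _ (by rw [abs_le]; constructor <;> linarith),
          abs_of_nonpos (by linarith), this, ← hr]
        ring
      · have hvb' : (e v : ℕ) ≠ e b := fun h => hvb (e.injective (Fin.ext h))
        have : (1 : ℝ) ≤ (e v : ℕ) := by
          have : 1 ≤ (e v : ℕ) := by omega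
          exact_mod_cast this
        rw [if_neg hvb, hat0]
        · ring
        · rw [le_abs]
          right
          linarith

theorem cyclePath_zero_eq (hN : 2 ≤ N) : cyclePath e 0 = cyclePath e N := by
  let a : V := e.symm ⟨N - 1, by omega⟩
  let b : V := e.symm ⟨0, by omega⟩
  have ha : (e a : ℕ) = N - 1 := by simp [a]
  have hb : (e b : ℕ) = 0 := by simp [b]
  have hab : ((e a : ℕ) + 1) % N = e b := by
    rw [ha, hb, Nat.sub_add_cancel (by omega), Nat.mod_self]
  obtain ⟨c, hc⟩ := exists_next e b
  have h1 := cyclePath_eq hN hab (s := 1) (by simp)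
  have h2 := cyclePath_eq hN hc (s := 0) (by simp)
  rw [AffineMap.lineMap_apply_one, ha, Nat.cast_sub (by omega), Nat.cast_one,
    sub_add_cancel] at h1
  rw [AffineMap.lineMap_apply_zero, hb, Nat.cast_zero, add_zero] at h2
  rw [h1, h2]

theorem cyclePath_mem (hN : 2 ≤ N) {t : ℝ} (ht : t ∈ Set.Icc (0 : ℝ) N) :
    cyclePath e t ∈ space (cycleSubgraph e) := by
  have key : ∀ t ∈ Set.Ico (0 : ℝ) N, cyclePath e t ∈ space (cycleSubgraph e) := by
    intro t ht
    obtain ⟨a, s, hs, rfl⟩ := exists_eq_add e ht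
    obtain ⟨b, hab⟩ := exists_next e a
    rw [cyclePath_eq hN hab ⟨hs.1, hs.2.le⟩]
    refine Or.inr ⟨a, b, ⟨next_ne hN hab, Or.inl hab⟩, ?_⟩
    rw [segment_eq_image_lineMap]
    exact ⟨s, ⟨hs.1, hs.2.le⟩, rfl⟩
  rcases ht.2.lt_or_eq with h | rfl
  · exact key t ⟨ht.1, h⟩
  · rw [← cyclePath_zero_eq hN]
    exact key 0 ⟨le_rfl, by exact_mod_cast (show 0 < N by omega)⟩

theorem exists_cyclePath_eq (hN : 2 ≤ N) {p : V → ℝ} (hp : p ∈ space (cycleSubgraph e)) :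
    ∃ t ∈ Set.Ico (0 : ℝ) N, cyclePath e t = p := by
  have hmem : ∀ a : V, ((e a : ℕ) : ℝ) ∈ Set.Ico (0 : ℝ) N := fun a =>
    ⟨Nat.cast_nonneg _, by exact_mod_cast (e a).2⟩
  have hvert : ∀ a : V, cyclePath e (e a : ℕ) = vertexPoint a := by
    intro a
    obtain ⟨b, hab⟩ := exists_next e a
    simpa using cyclePath_eq hN hab (s := 0) (by simp)
  have hedge : ∀ a b : V, ((e a : ℕ) + 1) % N = e b →
      p ∈ segment ℝ (vertexPoint a) (vertexPoint b) → ∃ t ∈ Set.Ico (0 : ℝ) N, cyclePath e t = p := by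
    intro a b hab hp
    obtain ⟨s, hs, rfl⟩ := exists_eq_lineMap_of_mem_segment hp
    rcases hs.2.lt_or_eq with h | rfl
    · have : ((e a : ℕ) : ℝ) + 1 ≤ N := by exact_mod_cast (e a).2
      have := hmem a
      exact ⟨(e a : ℕ) + s, ⟨add_nonneg this.1 hs.1, by linarith⟩, cyclePath_eq hN hab hs⟩
    · exact ⟨(e b : ℕ), hmem b, by rw [hvert, AffineMap.lineMap_apply_one]⟩
  rcases hp with ⟨a, -, rfl⟩ | ⟨a, b, ⟨-, hab | hab⟩, hp⟩
  · exact ⟨(e a : ℕ), hmem a, hvert a⟩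
  · exact hedge a b hab hp
  · exact hedge b a hab (segment_symm ℝ (vertexPoint a) (vertexPoint b) ▸ hp)

/-- The starting vertex of an edge has positive weight at every point before the far end. Equal
points on different edges would thus make `a` and `a'` successors of each other, impossible for `3 ≤
N`. -/
theorem injOn_cyclePath (hN : 3 ≤ N) : Set.InjOn (cyclePath e) (Set.Ico (0 : ℝ) N) := by
  intro t ht t' ht' h
  obtain ⟨a, s, hs, rfl⟩ := exists_eq_add e ht
  obtain ⟨a', s', hs', rfl⟩ := exists_eq_add e ht'
  obtain ⟨b, hab⟩ := exists_next e a
  obtain ⟨b', hab'⟩ := exists_next e a'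
  have hne := next_ne (by omega) hab
  have hne' := next_ne (by omega) hab'
  rw [cyclePath_eq (by omega) hab ⟨hs.1, hs.2.le⟩,
    cyclePath_eq (by omega) hab' ⟨hs'.1, hs'.2.le⟩] at h
  have h1 := congrFun h a
  have h2 := congrFun h a'
  simp only [lineMap_vertexPoint_apply, if_true, if_neg hne, if_neg hne'] at h1 h2
  by_cases haa : a = a'
  · subst haa
    rw [if_pos rfl, if_neg hne'] at h1
    linarith
  · rw [if_neg haa] at h1
    rw [if_neg (Ne.symm haa)] at h2
    have hab2 : a = b' := by
      by_contra hc
      rw [if_neg hc] at h1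
      linarith [hs.2]
    have hba2 : a' = b := by
      by_contra hc
      rw [if_neg hc] at h2
      linarith [hs'.2]
    subst hab2 hba2
    exfalso
    have e1 := (e a).2
    have e2 := (e a').2
    rcases Nat.lt_or_ge ((e a : ℕ) + 1) N with h | h
    · rw [Nat.mod_eq_of_lt h] at hab
      rcases Nat.lt_or_ge ((e a' : ℕ) + 1) N with h' | h'
      · rw [Nat.mod_eq_of_lt h'] at hab'
        omega
      · rw [show (e a' : ℕ) + 1 = N by omega, Nat.mod_self] at hab'
        omega
    · rw [show (e a : ℕ) + 1 = N by omega, Nat.mod_self] at hab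
      rw [← hab, Nat.mod_eq_of_lt (by omega)] at hab'
      omega

end HamiltonianCycle

/-! ### Increasing reparametrizations of an interval -/

theorem exists_strictMono_padding {m : ℕ} {lo hi : ℝ} (hlh : lo < hi) {s : Fin m → ℝ}
    (hs : StrictMono s) (hsm : ∀ i, s i ∈ Set.Ioo lo hi) :
    ∃ T : ℕ → ℝ, T 0 = lo ∧ T (m + 1) = hi ∧ (∀ i < m + 1, T i < T (i + 1)) ∧
      ∀ i : Fin m, T (i + 1) = s i := by
  refine ⟨fun k => if k = 0 then lo else if h : k - 1 < m then s ⟨k - 1, h⟩ else hi, by simp,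
    by simp, fun i hi' => ?_, fun i => by simp⟩
  rcases Nat.eq_zero_or_pos i with rfl | hpos
  · by_cases h : 0 < m
    · simpa [h] using (hsm ⟨0, h⟩).1
    · simpa [h] using hlh
  · have h1 : i - 1 < m := by omega
    by_cases h : i < m
    · simp only [hpos.ne', if_false, dif_pos h1, Nat.add_sub_cancel, Nat.succ_ne_zero, dif_pos h]
      exact hs (Fin.mk_lt_mk.2 (by omega))
    · simp only [hpos.ne', if_false, dif_pos h1, Nat.add_sub_cancel, Nat.succ_ne_zero, dif_neg h]
      exact (hsm _).2

theorem exists_strictMonoOn_interpolation {m : ℕ} {lo hi lo' hi' : ℝ} (h : lo < hi) (h' : lo' < hi')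
    {t x : Fin m → ℝ} (ht : StrictMono t) (hx : StrictMono x) (htm : ∀ i, t i ∈ Set.Ioo lo hi)
    (hxm : ∀ i, x i ∈ Set.Ioo lo' hi') :
    ∃ F : ℝ → ℝ, Continuous F ∧ StrictMonoOn F (Set.Icc lo hi) ∧ F lo = lo' ∧ F hi = hi' ∧
      ∀ i, F (t i) = x i := by
  obtain ⟨T, hT0, hT1, hT, hTt⟩ := exists_strictMono_padding h ht htm
  obtain ⟨X, hX0, hX1, hX, hXx⟩ := exists_strictMono_padding h' hx hxm
  obtain ⟨F, hF, hmono, hval⟩ := exists_continuous_strictMonoOn_interpolation (m + 1) T X hT hX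
  refine ⟨F, hF, hT0 ▸ hT1 ▸ hmono, ?_, ?_, fun i => ?_⟩
  · rw [← hT0, hval 0 (Nat.zero_le _), hX0]
  · rw [← hT1, hval _ le_rfl, hX1]
  · rw [← hTt, hval _ (by omega), hXx]

/-! ### From crossing edges on a Hamiltonian cycle to the chord diagram -/

section Realization

variable {V : Type*} [DecidableEq V] {N : ℕ} {e : V ≃ Fin N}
  {f : space (⊤ : (⊤ : SimpleGraph V).Subgraph) → Plane}

/-- Disjoint edges share no point, so the common image is a multiple point and genericity keeps it
away from the vertices. -/
theorem Crosses.exists_lineMap (hf : IsGenericImmersion (⊤ : (⊤ : SimpleGraph V).Subgraph) f)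
    {u v w x : V} (h : Crosses f u v w x) :
    ∃ s ∈ Set.Ioo (0 : ℝ) 1, ∃ t ∈ Set.Ioo (0 : ℝ) 1, ∃ p q, f p = f q ∧
      (p : V → ℝ) = AffineMap.lineMap (vertexPoint u) (vertexPoint v) s ∧
      (q : V → ℝ) = AffineMap.lineMap (vertexPoint w) (vertexPoint x) t := by
  obtain ⟨hnd, p, q, hpq, hp, hq⟩ := h
  simp only [List.nodup_cons, List.mem_cons, List.not_mem_nil, or_false, not_or] at hnd
  obtain ⟨⟨huv, huw, hux⟩, ⟨hvw, hvx⟩, -⟩ := hnd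
  obtain ⟨s, hs, hps⟩ := exists_eq_lineMap_of_mem_segment hp
  obtain ⟨t, ht, hqt⟩ := exists_eq_lineMap_of_mem_segment hq
  have hne : p ≠ q := by
    intro h
    rw [h, hqt] at hps
    have h1 := congrFun hps u
    have h2 := congrFun hps v
    simp only [lineMap_vertexPoint_apply, if_true, if_neg huv, if_neg (Ne.symm huv), if_neg huw,
      if_neg hux, if_neg hvw, if_neg hvx] at h1 h2
    linarith
  have hIoo : ∀ {a b : V} {r : ℝ} {z z'}, z ≠ z' → f z = f z' →
      (z : V → ℝ) = AffineMap.lineMap (vertexPoint a) (vertexPoint b) r → r ∈ Set.Icc (0 : ℝ) 1 →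
      r ∈ Set.Ioo (0 : ℝ) 1 := by
    intro a b r z z' hzz hfz hz hr
    refine ⟨lt_of_le_of_ne hr.1 ?_, lt_of_le_of_ne hr.2 ?_⟩
    · rintro rfl
      exact hf.interior z z' hzz hfz a (by rw [hz, AffineMap.lineMap_apply_zero])
    · rintro rfl
      exact hf.interior z z' hzz hfz b (by rw [hz, AffineMap.lineMap_apply_one])
  exact ⟨s, hIoo hne hpq hps hs, t, hIoo hne.symm hpq.symm hqt ht, p, q, hpq, hps, hqt⟩

theorem isCycleOfLength_cycleSubgraph (P : Circle ≃ₜ space (cycleSubgraph e)) :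
    IsCycleOfLength N (cycleSubgraph e) := by
  refine ⟨⟨P⟩, ?_⟩
  have : Finite V := Finite.of_equiv _ e.symm
  rw [show (cycleSubgraph e).verts = Set.univ from rfl, Set.ncard_univ, Nat.card_congr e,
    Nat.card_fin]

/-- If a Hamiltonian cycle has edges `u i`, `v i` in the cyclic order of the endpoints of a chord
diagram `C` such that the edges that correspond to the same chord cross, then it realizes `C`. -/
theorem exists_realization (hN : 3 ≤ N)
    (hf : IsGenericImmersion (⊤ : (⊤ : SimpleGraph V).Subgraph) f) {m : ℕ} (C : ChordDiagram Circle)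
    {b : Circle} {t : Fin m → ℝ} {τ : Fin m → Fin m} (ht : StrictMono t)
    (htm : ∀ i, t i ∈ Set.Ioo (0 : ℝ) 1) (hτ : Function.Involutive τ) (hτ' : ∀ i, τ i ≠ i)
    (hC : C.chords = {z | ∃ i, z = s(b * Circle.exp (2 * Real.pi * t i),
      b * Circle.exp (2 * Real.pi * t (τ i)))})
    {u v : Fin m → V} (huv : ∀ i, (e (u i) : ℕ) + 1 = e (v i))
    (hmono : ∀ i j, i < j → (e (u i) : ℕ) + 1 ≤ e (u j))
    (hcr : ∀ i, Crosses f (u i) (v i) (u (τ i)) (v (τ i))) :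
    ∃ γ : (⊤ : SimpleGraph V).Subgraph, IsCycleOfLength N γ ∧
      ∃ (o : CircleOrientation (space γ)) (D : ChordDiagram (space γ)),
        D.IsSub (hf.restrict (le_top : γ ≤ ⊤)).chordDiagram ∧
        ChordDiagram.Equivalent o D CircleOrientation.counterclockwise C := by
  have hN0 : (0 : ℝ) < N := by exact_mod_cast (show 0 < N by omega)
  choose s hs s' hs' p q hpq hp hq using fun i => (hcr i).exists_lineMap hf
  -- Crossings were chosen separately for `i` and for `τ i` and may differ; both ends of a chord use
  -- the one chosen at the smaller index.
  let y : Fin m → ℝ := fun i => if i < τ i then s i else s' (τ i)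
  let z : Fin m → space (⊤ : (⊤ : SimpleGraph V).Subgraph) := fun i =>
    if i < τ i then p i else q (τ i)
  have hy : ∀ i, y i ∈ Set.Ioo (0 : ℝ) 1 := by
    intro i
    simp only [y]
    split_ifs
    exacts [hs i, hs' _]
  have hfz : ∀ i, f (z i) = f (z (τ i)) := by
    intro i
    simp only [z, hτ i]
    rcases lt_or_gt_of_ne (hτ' i) with h | h
    · rw [if_neg h.not_gt, if_pos h, hpq]
    · rw [if_pos h, if_neg h.not_gt, hpq]
  have hzy : ∀ i, (z i : V → ℝ) = cyclePath e ((e (u i) : ℕ) + y i) := by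
    intro i
    rw [cyclePath_eq (by omega) (b := v i)
      (by rw [Nat.mod_eq_of_lt (by rw [huv]; exact (e (v i)).2), huv]) ⟨(hy i).1.le, (hy i).2.le⟩]
    simp only [z, y]
    split_ifs
    · exact hp i
    · rw [hq (τ i), hτ]
  let x : Fin m → ℝ := fun i => (e (u i) : ℕ) + y i
  have hx : StrictMono x := by
    intro i j hij
    have h : ((e (u i) : ℕ) : ℝ) + 1 ≤ (e (u j) : ℕ) := by exact_mod_cast hmono i j hij
    simp only [x]
    linarith [(hy i).2, (hy j).1]
  have hxm : ∀ i, x i ∈ Set.Ioo (0 : ℝ) N := by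
    intro i
    have h : ((e (u i) : ℕ) : ℝ) + 1 ≤ N := by exact_mod_cast (e (u i)).2
    have h' : (0 : ℝ) ≤ (e (u i) : ℕ) := Nat.cast_nonneg _
    exact ⟨by linarith [(hy i).1], by linarith [(hy i).2]⟩
  -- The parameters `x i` of the double points are in the order of the angles `t i`, so an
  -- increasing change of parameter matches them.
  obtain ⟨F, hF, hFmono, hF0, hF1, hFt⟩ :=
    exists_strictMonoOn_interpolation one_pos hN0 ht hx htm hxm
  have hclamp : ∀ T ∈ Set.Icc (0 : ℝ) 1, max 0 (min T 1) = T := fun T hT => by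
    rw [min_eq_left hT.2, max_eq_right hT.1]
  have hFmem : ∀ T ∈ Set.Icc (0 : ℝ) 1, F T ∈ Set.Icc (0 : ℝ) N := fun T hT => by
    rw [← hF0, ← hF1]
    exact ⟨hFmono.monotoneOn (by simp) hT hT.1, hFmono.monotoneOn hT (by simp) hT.2⟩
  have hFmem' : ∀ T ∈ Set.Ico (0 : ℝ) 1, F T ∈ Set.Ico (0 : ℝ) N := fun T hT =>
    ⟨(hFmem T ⟨hT.1, hT.2.le⟩).1, by
      rw [← hF1]
      exact hFmono ⟨hT.1, hT.2.le⟩ (by simp) hT.2⟩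
  let r : ℝ → space (cycleSubgraph e) := fun T => ⟨cyclePath e (F (max 0 (min T 1))),
    cyclePath_mem (by omega) (hFmem _ ⟨le_max_left _ _, max_le zero_le_one (min_le_right _ _)⟩)⟩
  have hr : ∀ T ∈ Set.Icc (0 : ℝ) 1, (r T : V → ℝ) = cyclePath e (F T) := fun T hT => by
    simp only [r]
    rw [hclamp T hT]
  obtain ⟨P, hP⟩ := exists_circle_homeomorph (r := r)
    (Continuous.continuousOn (((continuous_cyclePath e).comp
      (hF.comp (by fun_prop))).subtype_mk _))
    (Subtype.ext (by
      rw [hr 0 (by simp), hr 1 (by simp), hF0, hF1, cyclePath_zero_eq (by omega)]))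
    (fun T hT T' hT' h => by
      have h' := congrArg Subtype.val h
      rw [hr T ⟨hT.1, hT.2.le⟩, hr T' ⟨hT'.1, hT'.2.le⟩] at h'
      exact hFmono.injOn ⟨hT.1, hT.2.le⟩ ⟨hT'.1, hT'.2.le⟩
        (injOn_cyclePath hN (hFmem' T hT) (hFmem' T' hT') h'))
    (fun w => by
      obtain ⟨T', hT', hw⟩ := exists_cyclePath_eq (by omega) w.2
      have := intermediate_value_Ico zero_le_one hF.continuousOn
      rw [hF0, hF1] at this
      obtain ⟨T, hT, rfl⟩ := this hT'
      exact ⟨T, hT, Subtype.ext (by rw [hr T ⟨hT.1, hT.2.le⟩, hw])⟩)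
  let Q : Circle ≃ₜ space (cycleSubgraph e) := (Homeomorph.mulLeft b⁻¹).trans P
  have hQ : ∀ i, (Q (b * Circle.exp (2 * Real.pi * t i)) : V → ℝ) = z i := by
    intro i
    have : Q (b * Circle.exp (2 * Real.pi * t i)) = P (Circle.exp (2 * Real.pi * t i)) := by
      simp [Q]
    rw [this, hP _ ⟨(htm i).1.le, (htm i).2⟩, hr _ ⟨(htm i).1.le, (htm i).2.le⟩, hFt, hzy]
  -- Orientation and subdiagram are transported by `Q`, so the equivalence is `Q.symm`; only that
  -- paired points have equal images under `f` has content.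
  refine ⟨cycleSubgraph e, isCycleOfLength_cycleSubgraph P, CircleOrientation.ofHomeomorph Q,
    C.map Q Q.injective, ?_, Q.symm, fun _ h => h, ?_⟩
  · rintro _ ⟨c, hc, rfl⟩
    have hcd := C.not_isDiag c hc
    rw [hC] at hc
    obtain ⟨i, rfl⟩ := hc
    refine ⟨_, _, Q.injective.ne (by simpa using hcd), ?_, rfl⟩
    have hval : ∀ j, restrict (le_top : cycleSubgraph e ≤ ⊤) f
        (Q (b * Circle.exp (2 * Real.pi * t j))) = f (z j) := fun j =>
      congrArg f (Subtype.ext (hQ j))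
    rw [hval, hval, hfz]
  · simp only [ChordDiagram.map]
    rw [← Set.image_comp, Sym2.map_comp.symm]
    simp

end Realization

end PlaneCurves

/-! ### Assembly of the main theorem -/

theorem theorem1p1 (n : ℕ) (hn : 2 ≤ n) (C : ChordDiagram Circle) (hC : C.size = n)
    (f : space (⊤ : (K (4 * n)).Subgraph) → Plane)
    (hf : IsGenericImmersion (⊤ : (K (4 * n)).Subgraph) f) :
    ∃ γ : (K (4 * n)).Subgraph, IsCycleOfLength (4 * n) γ ∧
      ∃ (o : CircleOrientation (space γ)) (D : ChordDiagram (space γ)),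
        D.IsSub (hf.restrict (le_top : γ ≤ ⊤)).chordDiagram ∧
        ChordDiagram.Equivalent o D CircleOrientation.counterclockwise C := by
  obtain ⟨b, t, τ, ht, htm, hτ, hτ', hchords⟩ := C.exists_enumeration hC
  -- If 0 is paired with 1, then 1 is not paired with 2, which exists as `2 ≤ n`.
  obtain ⟨i₀, i₁, h01, hτ01⟩ : ∃ i₀ i₁ : Fin (2 * n), (i₀ : ℕ) + 1 = i₁ ∧ τ i₀ ≠ i₁ := by
    by_cases h : τ ⟨0, by omega⟩ = ⟨1, by omega⟩
    · refine ⟨⟨1, by omega⟩, ⟨2, by omega⟩, rfl, ?_⟩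
      rw [← h, hτ]
      simp
    · exact ⟨_, _, rfl, h⟩
  have hne : i₀ ≠ i₁ := by
    rintro rfl
    omega
  obtain ⟨w, hw, hw1, hw2⟩ := exists_vertex_arrangement hf hτ hτ' (by simp; omega) hne hτ01
  have hwbij : Function.Bijective w :=
    (Fintype.bijective_iff_injective_and_card w).2 ⟨hw, by simp; omega⟩
  -- The cycle visits `w (i, false)`, `w (i, true)` for `i = 0, 1, …` in turn.
  let e : Fin (4 * n) ≃ Fin (4 * n) := (Equiv.ofBijective w hwbij).symm.trans
    (((Equiv.refl _).prodCongr finTwoEquiv.symm).trans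
      (finProdFinEquiv.trans (finCongr (by omega))))
  have he : ∀ i c, (e (w (i, c)) : ℕ) = 2 * i + (if c then 1 else 0) := by
    intro i c
    have : (Equiv.ofBijective w hwbij).symm (w (i, c)) = (i, c) :=
      (Equiv.ofBijective w hwbij).symm_apply_apply (i, c)
    simp only [e, Equiv.trans_apply, this]
    cases c <;> simp [finTwoEquiv, finProdFinEquiv, add_comm]
  have hti : i₁ ≠ τ i₁ := (hτ' i₁).symm
  rcases hw2 with hw2 | hw2
  · refine exists_realization (e := e) (by omega) hf C ht htm hτ hτ' hchords
      (u := fun i => w (i, false)) (v := fun i => w (i, true)) (fun i => by simp [he])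
      (fun i j hij => ?_) (fun i => ?_)
    · have : (i : ℕ) < j := hij
      simp only [he]
      simp
      omega
    · by_cases h1 : i = i₁
      · rwa [h1]
      · by_cases h2 : i = τ i₁
        · rw [h2, hτ]
          exact hw2.symm
        · exact hw1 i h1 h2
  -- The edge for `i₁` is now the connecting one, in positions `2 * i₀ + 1` and `2 * i₀ + 2 = 2 *
  -- i₁`. It shares a vertex with the edge at `i₀`, which is harmless since double points are
  -- interior.
  · refine exists_realization (e := e) (by omega) hf C ht htm hτ hτ' hchords
      (u := fun i => if i = i₁ then w (i₀, true) else w (i, false))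
      (v := fun i => if i = i₁ then w (i₁, false) else w (i, true)) (fun i => ?_)
      (fun i j hij => ?_) (fun i => ?_)
    · split_ifs with h
      · rw [he, he]
        simp
        omega
      · simp [he]
    · have : (i : ℕ) < j := hij
      split_ifs with h1 h2 h2 <;> simp only [he] <;> simp <;> grind
    · by_cases h1 : i = i₁
      · simpa [h1, hτ' i₁] using hw2
      · by_cases h2 : i = τ i₁
        · simpa [h2, hτ i₁, hτ' i₁] using hw2.symm
        · have h3 : τ i ≠ i₁ := fun h => h2 (by rw [← h, hτ])
          simpa [h1, h3] using hw1 i h1 h2
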